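/- **Setting.** Let $x\sim\mathcal N(0,\Gamma_{\rm pr})$ in $\mathbb R^{\ell}$ and $y\mid x\sim\mathcal N(Gx,\Gamma_{\rm obs})$ in $\mathbb R^{m}$, that is, $y=Gx+\varepsilon$ with $\varepsilon\sim\mathcal N(0,\Gamma_{\rm obs})$ independent of $x$, where $G\in\mathbb R^{m\times\ell}$ and $\Gamma_{\rm pr},\Gamma_{\rm obs}$ are symmetric positive definite. Put $H=G^\top\Gamma_{\rm obs}^{-1}G$, $\Gamma_{\rm pos}=(H+\Gamma_{\rm pr}^{-1})^{-1}$ (the posterior covariance), $\mu_{\rm pos}(y)=\mathbb E(x\mid y)$, $\|z\|_S^2=z^\top Sz$ and, for an integer $r\ge 0$, $\mathcal A_r=\{A\in\mathbb R^{\ell\times m}:\operatorname{rank}A\le r\}$. Let $\delta_1\ge\dots\ge\delta_\ell\ge0$ and let $\widehat w_1,\dots,\widehat w_\ell\in\mathbb R^\ell$ be generalized eigenvectors of the pencil $(H,\Gamma_{\rm pr}^{-1})$, $H\widehat w_i=\delta_i^2\,\Gamma_{\rm pr}^{-1}\widehat w_i$, normalized by $\widehat w_i^\top\Gamma_{\rm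 pr}^{-1}\widehat w_j=\mathbf 1_{\{i=j\}}$. Let $\widehat v_1,\dots,\widehat v_m\in\mathbb R^m$ be generalized eigenvectors of the pencil $(G\Gamma_{\rm pr}G^\top,\Gamma_{\rm obs})$ associated with a non-increasing sequence of eigenvalues, with the normalization $\widehat v_i^\top\Gamma_{\rm obs}\widehat v_i=1$. The two families are matched as left and right singular vectors: $G\widehat w_i=\delta_i\,\Gamma_{\rm obs}\widehat v_i$ for all $i\le\min(\ell,m)$. **Theorem 4.1.** All the expectations below are finite, and: (i) the matrix $$A^\ast=\sum_{i=1}^{\min(r,\ell,m)}\frac{\delta_i}{1+\delta_i^2}\,\widehat w_i\widehat v_i^\top$$ belongs to $\mathcal A_r$ and minimizes the Bayes risk $A\mapsto\mathbb E\big(\|Ay-x\|^2_{\Gamma_{\rm pos}^{-1}}\big)$ over $\mathcal A_r$; (ii) the minimum Bayes risk over $\mathcal A_r$ is $$\mathbb E\big(\|A^\ast y-x\|^2_{\Gamma_{\rm pos}^{-1}}\big)=\mathbb E\big(\|A^\ast y-\mu_{\rm pos}(y)\|^2_{\Gamma_{\rm pos}^{-1}}\big)+\mathbb E\big(\|\mu_{\rm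 pos}(y)-x\|^2_{\Gamma_{\rm pos}^{-1}}\big)=\sum_{i=r+1}^{\ell}\delta_i^2+\ell .$$ -/

import Mathlib

open MeasureTheory ProbabilityTheory Matrix

/-- The linear Gaussian model `y ∣ x ∼ 𝒩(G x, Γobs)`, `x ∼ 𝒩(0, Γpr)`, for random vectors `X` and
`Y` on a common probability space: `X` has the prior law, and the noise `Y - G X` is independent of
`X` with law `𝒩(0, Γobs)`. -/
structure IsLinearGaussianModel {n m : ℕ} {Ω : Type*} [MeasurableSpace Ω] (P : Measure Ω)
    (G : Matrix (Fin m) (Fin n) ℝ) (Γpr : Matrix (Fin n) (Fin n) ℝ)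
    (Γobs : Matrix (Fin m) (Fin m) ℝ)
    (X : Ω → EuclideanSpace ℝ (Fin n)) (Y : Ω → EuclideanSpace ℝ (Fin m)) : Prop where
  measurable_param : Measurable X
  measurable_data : Measurable Y
  prior : HasLaw X (multivariateGaussian 0 Γpr) P
  noise : HasLaw (fun ω => Y ω - toEuclideanLin G (X ω)) (multivariateGaussian 0 Γobs) P
  indep : IndepFun X (fun ω => Y ω - toEuclideanLin G (X ω)) P

/-- The Hessian `H = Gᵀ Γobs⁻¹ G` of the negative log-likelihood. -/
noncomputable def hessian {n m : ℕ} (G : Matrix (Fin m) (Fin n) ℝ)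
    (Γobs : Matrix (Fin m) (Fin m) ℝ) : Matrix (Fin n) (Fin n) ℝ :=
  Gᵀ * Γobs⁻¹ * G

/-- The posterior covariance matrix `Γpos = (H + Γpr⁻¹)⁻¹`. -/
noncomputable def posteriorCov {n m : ℕ} (G : Matrix (Fin m) (Fin n) ℝ)
    (Γpr : Matrix (Fin n) (Fin n) ℝ) (Γobs : Matrix (Fin m) (Fin m) ℝ) :
    Matrix (Fin n) (Fin n) ℝ :=
  (hessian G Γobs + Γpr⁻¹)⁻¹

/-- The posterior mean `μ_pos(y) = 𝔼(x ∣ y)`, as a random vector. -/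
noncomputable def posteriorMean {n m : ℕ} {Ω : Type*} [MeasurableSpace Ω] (P : Measure Ω)
    (X : Ω → EuclideanSpace ℝ (Fin n)) (Y : Ω → EuclideanSpace ℝ (Fin m)) :
    Ω → EuclideanSpace ℝ (Fin n) :=
  P[X | MeasurableSpace.comap Y inferInstance]

/-- The squared weighted norm `‖z‖²_S = zᵀ S z`. -/
noncomputable def weightedSq {n : ℕ} (S : Matrix (Fin n) (Fin n) ℝ)
    (z : EuclideanSpace ℝ (Fin n)) : ℝ :=
  z.ofLp ⬝ᵥ (S *ᵥ z.ofLp)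

/-- The Bayes risk `𝔼 ‖A y - x‖²_S` of the linear estimator `y ↦ A y`. -/
noncomputable def linearBayesRisk {n m : ℕ} {Ω : Type*} [MeasurableSpace Ω] (P : Measure Ω)
    (X : Ω → EuclideanSpace ℝ (Fin n)) (Y : Ω → EuclideanSpace ℝ (Fin m))
    (S : Matrix (Fin n) (Fin n) ℝ) (A : Matrix (Fin n) (Fin m) ℝ) : ℝ :=
  ∫ ω, weightedSq S (toEuclideanLin A (Y ω) - X ω) ∂P

/-- The class of matrices of rank at most `r`. -/
def rankAtMost (n m r : ℕ) : Set (Matrix (Fin n) (Fin m) ℝ) :=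
  {A | A.rank ≤ r}

/-- `u` is a generalized eigenvector of the pencil `(A, B)` with eigenvalue `c`. -/
def IsGenEigenpair {k : ℕ} (A B : Matrix (Fin k) (Fin k) ℝ) (c : ℝ) (u : Fin k → ℝ) : Prop :=
  u ≠ 0 ∧ A *ᵥ u = c • (B *ᵥ u)

/-- `A* = ∑_{i ≤ r} δ_i / (1 + δ_i²) w_i v_iᵀ`. Indices start at `0` here, and the sum runs over
the indices `i < r` for which both `w_i` (`i < n`) and `v_i` (`i < m`) exist. -/
noncomputable def optimalLowRank {n m : ℕ} (r : ℕ) (δ : Fin n → ℝ)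
    (w : Fin n → Fin n → ℝ) (v : Fin m → Fin m → ℝ) : Matrix (Fin n) (Fin m) ℝ :=
  ∑ i : Fin n, ∑ j : Fin m,
    if (i : ℕ) = (j : ℕ) ∧ (i : ℕ) < r then
      (δ i / (1 + δ i ^ 2)) • vecMulVec (w i) (v j)
    else 0

/-! Write `S = Γpos⁻¹`, `V = G Γpr Gᵀ + Γobs` for the data covariance and `B = Γpos Gᵀ Γobs⁻¹`
(`posteriorGain`). Since `B V = Γpr Gᵀ`, the residual `X - B Y` is uncorrelated with `Y`, hence
independent of it by joint Gaussianity, and the posterior mean is `B Y` (`posteriorMean_ae_eq`).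
Completing the square (`errorCov_eq`), the error covariance of `A Y` is `(A - B) V (A - B)ᵀ + Γpos`.
Weighted by `S`, the second term contributes the trace of the identity, which is the constant
dimension term of the risk.

The first term is a low-rank approximation problem. With `Fᵀ F = S` and `L Lᵀ = V`, it equals the
squared Frobenius norm of `F A L - F B L`. For the `F` built from the eigenbasis (`whitening`), the
Gram matrix of `F B L` is `diagonal (δ²)` (`whitened_posteriorGain_cov`). The Eckart-Young bound
(`sum_tail_le_trace_sub_mul_transpose`) then gives the tail sum of `δ²` as a lower bound. It is
attained because `F A*` is `F B` with all rows but the first `r` set to zero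
(`whitening_mul_optimalLowRank`). -/

/-! ### Low-rank approximation in the Frobenius norm. -/

/-- Every real matrix admits an orthogonal projection matrix onto its column space. -/
lemma exists_columnProjection {n m : ℕ} (C : Matrix (Fin n) (Fin m) ℝ) :
    ∃ Q : Matrix (Fin n) (Fin n) ℝ, Qᵀ = Q ∧ Q * Q = Q ∧ Q.trace = C.rank ∧ Q * C = C := by
  classical
  set K : Submodule ℝ (EuclideanSpace ℝ (Fin n)) := LinearMap.range (toEuclideanLin C) with hK
  let e := Matrix.toEuclideanCLM (n := Fin n) (𝕜 := ℝ)
  let Q := e.symm K.starProjection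
  have heQ : e Q = K.starProjection := e.apply_symm_apply _
  have happ : ∀ z, toEuclideanLin Q z = K.starProjection z := fun z => by
    rw [← heQ]; rfl
  refine ⟨Q, ?_, ?_, ?_, ?_⟩
  · have h : star Q = Q := by
      apply EquivLike.injective e
      rw [map_star, heQ]
      exact isSelfAdjoint_starProjection K
    simpa [star_eq_conjTranspose] using h
  · apply EquivLike.injective e
    rw [map_mul, heQ]
    exact K.isIdempotentElem_starProjection
  · have h1 : LinearMap.trace ℝ _ (toEuclideanLin Q) = Q.trace := by
      rw [toEuclideanLin_eq_toLin_orthonormal, LinearMap.trace_eq_matrix_trace ℝ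
        (EuclideanSpace.basisFun (Fin n) ℝ).toBasis, LinearMap.toMatrix_toLin]
    have h2 : LinearMap.IsProj K (toEuclideanLin Q) :=
      ⟨fun x => by rw [happ]; exact K.starProjection_apply_mem x,
        fun x hx => by rw [happ]; exact K.starProjection_eq_self_iff.2 hx⟩
    rw [← h1, h2.trace, C.rank_eq_finrank_range_toLin (EuclideanSpace.basisFun (Fin n) ℝ).toBasis
      (EuclideanSpace.basisFun (Fin m) ℝ).toBasis, ← toEuclideanLin_eq_toLin_orthonormal]
  · apply (toEuclideanLin (𝕜 := ℝ)).injective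
    ext1 z
    have h : toEuclideanLin (Q * C) z = toEuclideanLin Q (toEuclideanLin C z) := by
      simp [toLpLin_apply, mulVec_mulVec]
    rw [h, happ]
    exact K.starProjection_eq_self_iff.2 ⟨z, rfl⟩

lemma trace_mul_transpose_nonneg {n m : ℕ} (M : Matrix (Fin n) (Fin m) ℝ) :
    0 ≤ (M * Mᵀ).trace := by
  simp only [trace, diag_apply, mul_apply, transpose_apply]
  exact Finset.sum_nonneg fun i _ => Finset.sum_nonneg fun j _ => mul_self_nonneg _

/-- A linear program: with weights in `[0, 1]` of total mass at most `r`, the best choice is to put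
them on the `r` largest entries. -/
lemma sum_tail_le_sum_mul_one_sub {n r : ℕ} {d p : Fin n → ℝ} (hd : Antitone d)
    (hd0 : ∀ i, 0 ≤ d i) (hp0 : ∀ i, 0 ≤ p i) (hp1 : ∀ i, p i ≤ 1) (hp : ∑ i, p i ≤ r) :
    ∑ i ∈ Finset.univ.filter (fun i : Fin n => r ≤ (i : ℕ)), d i ≤ ∑ i, d i * (1 - p i) := by
  rcases le_or_gt n r with hr | hr
  · rw [Finset.filter_false_of_mem fun i _ => by omega, Finset.sum_empty]
    exact Finset.sum_nonneg fun i _ => mul_nonneg (hd0 i) (by linarith [hp1 i])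
  · set c := d ⟨r, hr⟩
    have hcard : ∑ i : Fin n, (if r ≤ (i : ℕ) then (1 : ℝ) else 0) = n - r := by
      rw [Fin.sum_univ_eq_sum_range (fun i => if r ≤ i then (1 : ℝ) else 0), Finset.sum_boole]
      have : (Finset.range n).filter (fun i => r ≤ i) = Finset.Ico r n := by
        ext; simp [and_comm]
      rw [this, Nat.card_Ico, Nat.cast_sub hr.le]
    -- Equivalent to `(d i - c) * (1 - p i - 1_{r ≤ i}) ≥ 0`: the two factors have the same sign on
    -- either side of the threshold index `r`.
    have hterm : ∀ i, c * (1 - p i) - c * (if r ≤ (i : ℕ) then (1 : ℝ) else 0) ≤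
        d i * (1 - p i) - (if r ≤ (i : ℕ) then d i else 0) := by
      intro i
      split_ifs with hi
      · have : d i ≤ c := hd (show (⟨r, hr⟩ : Fin n) ≤ i from hi)
        nlinarith [hp0 i]
      · have : c ≤ d i := hd (show i ≤ (⟨r, hr⟩ : Fin n) from (not_le.1 hi).le)
        nlinarith [hp1 i]
    have hsum := Finset.sum_le_sum fun i (_ : i ∈ Finset.univ) => hterm i
    simp only [Finset.sum_sub_distrib, ← Finset.mul_sum, hcard] at hsum
    rw [Finset.sum_filter]
    simp only [Finset.sum_const, Finset.card_univ, Fintype.card_fin, nsmul_eq_mul, mul_one] at hsum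
    nlinarith [hd0 ⟨r, hr⟩]

/-- The Frobenius-norm low-rank approximation bound (Eckart-Young-Mirsky), for a matrix whose left
singular vectors are the standard basis. -/
lemma sum_tail_le_trace_sub_mul_transpose {n m r : ℕ} {C D : Matrix (Fin n) (Fin m) ℝ}
    {d : Fin n → ℝ} (hd : Antitone d) (hd0 : ∀ i, 0 ≤ d i) (hD : D * Dᵀ = diagonal d)
    (hC : C.rank ≤ r) :
    ∑ i ∈ Finset.univ.filter (fun i : Fin n => r ≤ (i : ℕ)), d i ≤
      ((C - D) * (C - D)ᵀ).trace := by
  obtain ⟨Q, hQt, hQQ, hQtr, hQC⟩ := exists_columnProjection C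
  -- Symmetry and idempotence make each diagonal entry the squared norm of its row, which forces it
  -- into `[0, 1]`.
  have hdiag : ∀ i, Q i i = ∑ j, Q i j ^ 2 := fun i => by
    conv_lhs => rw [← hQQ, mul_apply]
    refine Finset.sum_congr rfl fun j _ => ?_
    rw [sq, ← congrFun (congrFun hQt i) j, transpose_apply]
  have hp0 : ∀ i, 0 ≤ Q i i := fun i => by
    rw [hdiag]; positivity
  have hp1 : ∀ i, Q i i ≤ 1 := fun i => by
    have : Q i i ^ 2 ≤ Q i i := by
      conv_rhs => rw [hdiag]
      exact Finset.single_le_sum (f := fun j => Q i j ^ 2) (fun _ _ => sq_nonneg _)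
        (Finset.mem_univ i)
    nlinarith
  have hp : ∑ i, Q i i ≤ r := by
    have : ∑ i, Q i i = C.rank := hQtr
    rw [this]; exact_mod_cast hC
  refine (sum_tail_le_sum_mul_one_sub hd hd0 hp0 hp1 hp).trans ?_
  set M := C - D with hM
  -- Off the column space of `C` the error no longer depends on `C`.
  have h1 : (1 - Q) * M = -((1 - Q) * D) := by
    rw [hM, Matrix.mul_sub, Matrix.sub_mul 1 Q C, hQC]; simp
  have hidem : (1 - Q)ᵀ * (1 - Q) = 1 - Q := by
    simp [hQt, Matrix.mul_sub, Matrix.sub_mul, hQQ]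
  have h2 : (((1 - Q) * M) * ((1 - Q) * M)ᵀ).trace = ∑ i, d i * (1 - Q i i) := by
    rw [h1, transpose_neg, Matrix.neg_mul, Matrix.mul_neg, neg_neg, transpose_mul, Matrix.mul_assoc, ← Matrix.mul_assoc D, hD,
      trace_mul_comm, Matrix.mul_assoc, hidem]
    simp [trace, diagonal_mul]
  -- Pythagoras for the complementary projections `1 - Q` and `Q`.
  have h3 : (M * Mᵀ).trace = (((1 - Q) * M) * ((1 - Q) * M)ᵀ).trace +
      ((Q * M) * (Q * M)ᵀ).trace := by
    have ha : ∀ R : Matrix (Fin n) (Fin n) ℝ, Rᵀ * R = R →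
        ((R * M) * (R * M)ᵀ).trace = (R * (M * Mᵀ)).trace := fun R hR => by
      rw [transpose_mul, trace_mul_comm, Matrix.mul_assoc, ← Matrix.mul_assoc Rᵀ, hR,
        trace_mul_comm, Matrix.mul_assoc]
    rw [ha _ hidem, ha _ (by rw [hQt, hQQ]), ← trace_add, ← Matrix.add_mul]
    simp
  rw [h3, h2]
  linarith [trace_mul_transpose_nonneg (Q * M)]

/-! ### Second moments of linear images of a random vector. -/

section SecondMoments

variable {Ω : Type*} [MeasurableSpace Ω] {P : Measure Ω} {ι κ κ' : Type*} [Fintype ι]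

lemma memLp_mulVec {Z : Ω → ι → ℝ} (hZ : ∀ a, MemLp (fun ω => Z ω a) 2 P) (A : Matrix κ ι ℝ)
    (i : κ) : MemLp (fun ω => (A *ᵥ Z ω) i) 2 P := by
  simp only [mulVec, dotProduct]
  exact memLp_finsetSum _ fun a _ => (hZ a).const_mul (A i a)

lemma integral_mulVec_eq_zero {Z : Ω → ι → ℝ} (hZ : ∀ a, Integrable (fun ω => Z ω a) P)
    (h0 : ∀ a, ∫ ω, Z ω a ∂P = 0) (A : Matrix κ ι ℝ) (i : κ) : ∫ ω, (A *ᵥ Z ω) i ∂P = 0 := by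
  simp only [mulVec, dotProduct]
  rw [integral_finsetSum _ fun a _ => (hZ a).const_mul (A i a)]
  simp [integral_const_mul, h0]

lemma integral_mulVec_mul_mulVec {Z : Ω → ι → ℝ} (hZ : ∀ a, MemLp (fun ω => Z ω a) 2 P)
    {K : Matrix ι ι ℝ} (hK : ∀ a b, ∫ ω, Z ω a * Z ω b ∂P = K a b)
    (A : Matrix κ ι ℝ) (B : Matrix κ' ι ℝ) (i : κ) (j : κ') :
    ∫ ω, (A *ᵥ Z ω) i * (B *ᵥ Z ω) j ∂P = (A * K * Bᵀ) i j := by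
  have hint : ∀ a b, Integrable (fun ω => A i a * B j b * (Z ω a * Z ω b)) P := fun a b =>
    ((hZ a).integrable_mul (hZ b)).const_mul _
  have h : ∀ ω, (A *ᵥ Z ω) i * (B *ᵥ Z ω) j =
      ∑ b, ∑ a, A i a * B j b * (Z ω a * Z ω b) := fun ω => by
    simp only [mulVec, dotProduct, Finset.sum_mul_sum]
    rw [Finset.sum_comm]
    exact Finset.sum_congr rfl fun b _ => Finset.sum_congr rfl fun a _ => by ring
  simp only [h]
  rw [integral_finsetSum _ fun b _ => integrable_finsetSum _ fun a _ => hint a b]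
  simp only [mul_apply, transpose_apply, Finset.sum_mul]
  refine Finset.sum_congr rfl fun b _ => ?_
  rw [integral_finsetSum _ fun a _ => hint a b]
  refine Finset.sum_congr rfl fun a _ => ?_
  rw [integral_const_mul, hK]; ring

lemma integrable_dotProduct_mulVec [Fintype κ] {U : Ω → κ → ℝ} (hU : ∀ a, MemLp (fun ω => U ω a) 2 P)
    (S : Matrix κ κ ℝ) : Integrable (fun ω => U ω ⬝ᵥ (S *ᵥ U ω)) P := by
  simp only [dotProduct]
  exact integrable_finsetSum _ fun i _ => (hU i).integrable_mul (memLp_mulVec hU S i)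

lemma integral_dotProduct_mulVec [Fintype κ] {Z : Ω → ι → ℝ} (hZ : ∀ a, MemLp (fun ω => Z ω a) 2 P)
    {K : Matrix ι ι ℝ} (hK : ∀ a b, ∫ ω, Z ω a * Z ω b ∂P = K a b)
    (A : Matrix κ ι ℝ) (S : Matrix κ κ ℝ) :
    ∫ ω, (A *ᵥ Z ω) ⬝ᵥ (S *ᵥ (A *ᵥ Z ω)) ∂P = (S * (A * K * Aᵀ)).trace := by
  have hU := memLp_mulVec hZ A
  have hint : ∀ i, Integrable (fun ω => (A *ᵥ Z ω) i * (S *ᵥ (A *ᵥ Z ω)) i) P := fun i =>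
    (hU i).integrable_mul (memLp_mulVec hU S i)
  simp only [dotProduct]
  rw [integral_finsetSum _ fun i _ => hint i, trace]
  refine Finset.sum_congr rfl fun i _ => ?_
  have h := integral_mulVec_mul_mulVec hZ hK (S * A) A i i
  simp only [← mulVec_mulVec] at h
  simp only [mul_comm ((A *ᵥ Z _) i), h, diag_apply, Matrix.mul_assoc]

end SecondMoments

/-! ### Moments of the coordinates of a centred Gaussian vector. -/

lemma memLp_eval_of_hasLaw {k : ℕ} {Ω : Type*} [MeasurableSpace Ω] {P : Measure Ω}
    {S : Matrix (Fin k) (Fin k) ℝ} {V : Ω → EuclideanSpace ℝ (Fin k)}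
    (hV : HasLaw V (multivariateGaussian 0 S) P) (i : Fin k) : MemLp (fun ω => V ω i) 2 P :=
  (hV.hasGaussianLaw.map_fun (EuclideanSpace.proj i)).memLp_two

lemma integral_eval_of_hasLaw {k : ℕ} {Ω : Type*} [MeasurableSpace Ω] {P : Measure Ω}
    {S : Matrix (Fin k) (Fin k) ℝ} {V : Ω → EuclideanSpace ℝ (Fin k)}
    (hV : HasLaw V (multivariateGaussian 0 S) P) (i : Fin k) : ∫ ω, V ω i ∂P = 0 := by
  have h := (EuclideanSpace.proj (𝕜 := ℝ) i).integral_comp_comm hV.hasGaussianLaw.integrable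
  rw [hV.integral_eq, integral_id_multivariateGaussian] at h
  simpa using h

lemma integral_eval_mul_eval_of_hasLaw {k : ℕ} {Ω : Type*} [MeasurableSpace Ω] {P : Measure Ω}
    [IsProbabilityMeasure P] {S : Matrix (Fin k) (Fin k) ℝ} (hS : S.PosSemidef)
    {V : Ω → EuclideanSpace ℝ (Fin k)} (hV : HasLaw V (multivariateGaussian 0 S) P)
    (i j : Fin k) : ∫ ω, V ω i * V ω j ∂P = S i j := by
  have h := hV.covariance_fun_comp (f := fun x => x i) (g := fun x => x j) (by fun_prop)
    (by fun_prop)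
  rw [covariance_eval_multivariateGaussian hS, covariance_eq_sub (memLp_eval_of_hasLaw hV i)
    (memLp_eval_of_hasLaw hV j), integral_eval_of_hasLaw hV i] at h
  simpa using h

/-! ### The linear Gaussian model and its posterior mean. -/

section Model

variable {n m : ℕ} {G : Matrix (Fin m) (Fin n) ℝ} {Γpr : Matrix (Fin n) (Fin n) ℝ}
  {Γobs : Matrix (Fin m) (Fin m) ℝ} {Ω : Type*} [MeasurableSpace Ω] {P : Measure Ω}
  {X : Ω → EuclideanSpace ℝ (Fin n)} {Y : Ω → EuclideanSpace ℝ (Fin m)}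

/-- The parameter and the noise, stacked into one vector. -/
noncomputable def paramNoise (G : Matrix (Fin m) (Fin n) ℝ)
    (X : Ω → EuclideanSpace ℝ (Fin n)) (Y : Ω → EuclideanSpace ℝ (Fin m)) (ω : Ω) :
    Fin n ⊕ Fin m → ℝ :=
  Sum.elim (X ω).ofLp (Y ω - toEuclideanLin G (X ω)).ofLp

omit [MeasurableSpace Ω] in
lemma fromCols_mulVec_paramNoise {k : ℕ} (M : Matrix (Fin k) (Fin n) ℝ)
    (N : Matrix (Fin k) (Fin m) ℝ) (ω : Ω) :
    fromCols M N *ᵥ paramNoise G X Y ω =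
      M *ᵥ (X ω).ofLp + N *ᵥ ((Y ω).ofLp - G *ᵥ (X ω).ofLp) := by
  simp [paramNoise, fromCols_mulVec]

lemma IsLinearGaussianModel.memLp_paramNoise
    (h : IsLinearGaussianModel P G Γpr Γobs X Y) (a : Fin n ⊕ Fin m) :
    MemLp (fun ω => paramNoise G X Y ω a) 2 P := by
  cases a with
  | inl i => exact memLp_eval_of_hasLaw h.prior i
  | inr j => exact memLp_eval_of_hasLaw h.noise j

lemma IsLinearGaussianModel.integral_paramNoise
    (h : IsLinearGaussianModel P G Γpr Γobs X Y) (a : Fin n ⊕ Fin m) :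
    ∫ ω, paramNoise G X Y ω a ∂P = 0 := by
  cases a with
  | inl i => exact integral_eval_of_hasLaw h.prior i
  | inr j => exact integral_eval_of_hasLaw h.noise j

lemma IsLinearGaussianModel.integral_paramNoise_mul [IsProbabilityMeasure P]
    (h : IsLinearGaussianModel P G Γpr Γobs X Y) (hpr : Γpr.PosSemidef) (hobs : Γobs.PosSemidef)
    (a b : Fin n ⊕ Fin m) :
    ∫ ω, paramNoise G X Y ω a * paramNoise G X Y ω b ∂P = fromBlocks Γpr 0 0 Γobs a b := by
  have hcross : ∀ i j, ∫ ω, X ω i * (Y ω - toEuclideanLin G (X ω)) j ∂P = 0 := fun i j => by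
    have hind := h.indep.comp (φ := fun x => x i) (ψ := fun y => y j) (by fun_prop) (by fun_prop)
    have := hind.integral_mul_eq_mul_integral
      (memLp_eval_of_hasLaw h.prior i).aestronglyMeasurable
      (memLp_eval_of_hasLaw h.noise j).aestronglyMeasurable
    refine this.trans ?_
    have h0 : ∫ ω, ((fun x : EuclideanSpace ℝ (Fin n) => x i) ∘ X) ω ∂P = 0 :=
      integral_eval_of_hasLaw h.prior i
    rw [h0, zero_mul]
  rcases a with i | j <;> rcases b with k | l
  · exact integral_eval_mul_eval_of_hasLaw hpr h.prior i k
  · exact hcross i l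
  · simp only [mul_comm (paramNoise G X Y _ (Sum.inr j))]
    exact hcross k j
  · exact integral_eval_mul_eval_of_hasLaw hobs h.noise j l

/-- Estimation errors are linear images of `paramNoise`, whose second-moment matrix is block
diagonal, so every expected loss reduces to a trace. -/
lemma IsLinearGaussianModel.integral_weightedSq [IsProbabilityMeasure P] {k : ℕ}
    (h : IsLinearGaussianModel P G Γpr Γobs X Y) (hpr : Γpr.PosSemidef) (hobs : Γobs.PosSemidef)
    (S : Matrix (Fin k) (Fin k) ℝ) (M : Matrix (Fin k) (Fin n) ℝ) (N : Matrix (Fin k) (Fin m) ℝ)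
    {U : Ω → EuclideanSpace ℝ (Fin k)}
    (hU : ∀ ω, (U ω).ofLp = fromCols M N *ᵥ paramNoise G X Y ω) :
    ∫ ω, weightedSq S (U ω) ∂P = (S * (M * Γpr * Mᵀ + N * Γobs * Nᵀ)).trace := by
  simp only [weightedSq, hU]
  rw [integral_dotProduct_mulVec h.memLp_paramNoise (h.integral_paramNoise_mul hpr hobs),
    fromCols_mul_fromBlocks, transpose_fromCols, fromCols_mul_fromRows]
  simp

lemma IsLinearGaussianModel.integrable_weightedSq {k : ℕ}
    (h : IsLinearGaussianModel P G Γpr Γobs X Y)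
    (S : Matrix (Fin k) (Fin k) ℝ) (M : Matrix (Fin k) (Fin n) ℝ) (N : Matrix (Fin k) (Fin m) ℝ)
    {U : Ω → EuclideanSpace ℝ (Fin k)}
    (hU : ∀ ω, (U ω).ofLp = fromCols M N *ᵥ paramNoise G X Y ω) :
    Integrable (fun ω => weightedSq S (U ω)) P := by
  simp only [weightedSq, hU]
  exact integrable_dotProduct_mulVec (memLp_mulVec h.memLp_paramNoise _) S

/-- In the linear Gaussian model the conditional mean of the parameter is the linear estimator
`B y` solving the normal equations `B (G Γpr Gᵀ + Γobs) = Γpr Gᵀ`. -/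
lemma IsLinearGaussianModel.posteriorMean_ae_eq [IsProbabilityMeasure P]
    (h : IsLinearGaussianModel P G Γpr Γobs X Y) (hpr : Γpr.PosSemidef) (hobs : Γobs.PosSemidef)
    {B : Matrix (Fin n) (Fin m) ℝ} (hB : B * (G * Γpr * Gᵀ + Γobs) = Γpr * Gᵀ) :
    posteriorMean P X Y =ᵐ[P] fun ω => toEuclideanLin B (Y ω) := by
  set R : Ω → EuclideanSpace ℝ (Fin n) := fun ω => X ω - toEuclideanLin B (Y ω) with hR
  have hRZ : ∀ ω, (R ω).ofLp = fromCols (1 - B * G) (-B) *ᵥ paramNoise G X Y ω := fun ω => by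
    rw [fromCols_mulVec_paramNoise]
    simp [hR, Matrix.sub_mulVec, Matrix.neg_mulVec, Matrix.mulVec_sub]
    abel
  have hYZ : ∀ ω, (Y ω).ofLp = fromCols G 1 *ᵥ paramNoise G X Y ω := fun ω => by
    rw [fromCols_mulVec_paramNoise]; simp
  have hZ := h.memLp_paramNoise
  have hZ1 : ∀ a, Integrable (fun ω => paramNoise G X Y ω a) P := fun a =>
    (hZ a).integrable one_le_two
  have hpair : HasGaussianLaw (fun ω => (X ω, Y ω - toEuclideanLin G (X ω))) P :=
    h.indep.hasGaussianLaw h.prior.hasGaussianLaw h.noise.hasGaussianLaw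
  have hYlaw : HasGaussianLaw (fun ω => (X ω, Y ω)) P := by
    let L : EuclideanSpace ℝ (Fin n) × EuclideanSpace ℝ (Fin m) →ₗ[ℝ]
        EuclideanSpace ℝ (Fin n) × EuclideanSpace ℝ (Fin m) :=
      (LinearMap.fst ℝ _ _).prod
        (LinearMap.snd ℝ _ _ + (toEuclideanLin G).comp (LinearMap.fst ℝ _ _))
    simpa [L] using hpair.map_fun (LinearMap.toContinuousLinearMap L)
  have hRY : HasGaussianLaw (fun ω => (fun i => R ω i, fun j => Y ω j)) P := by
    let L : EuclideanSpace ℝ (Fin n) × EuclideanSpace ℝ (Fin m) →ₗ[ℝ]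
        (Fin n → ℝ) × (Fin m → ℝ) :=
      ((WithLp.linearEquiv 2 ℝ (Fin n → ℝ)).toLinearMap.comp
        (LinearMap.fst ℝ _ _ - (toEuclideanLin B).comp (LinearMap.snd ℝ _ _))).prod
        ((WithLp.linearEquiv 2 ℝ (Fin m → ℝ)).toLinearMap.comp (LinearMap.snd ℝ _ _))
    exact hYlaw.map_fun (LinearMap.toContinuousLinearMap L)
  -- The residual and the data are jointly Gaussian, so zero cross-covariance suffices.
  have hind : IndepFun R Y P := by
    have h1 : IndepFun (fun ω i => R ω i) (fun ω j => Y ω j) P := by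
      refine hRY.indepFun_of_covariance_eval fun i j => ?_
      simp only [hRZ, hYZ]
      rw [covariance_eq_sub (memLp_mulVec hZ _ i) (memLp_mulVec hZ _ j),
        integral_mulVec_eq_zero hZ1 h.integral_paramNoise, zero_mul, sub_zero]
      refine (integral_mulVec_mul_mulVec hZ (h.integral_paramNoise_mul hpr hobs) _ _ i j).trans ?_
      rw [fromCols_mul_fromBlocks, transpose_fromCols, fromCols_mul_fromRows]
      -- The cross-covariance of `R` and `Y` is `Γpr Gᵀ - B (G Γpr Gᵀ + Γobs)`, which the normal
      -- equations annihilate.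
      have : (1 - B * G) * Γpr * Gᵀ + -B * Γobs = 0 := by
        rw [Matrix.sub_mul, Matrix.sub_mul, Matrix.one_mul, ← hB, Matrix.mul_add]
        simp [Matrix.mul_assoc]
      simpa using congrFun (congrFun this i) j
    exact h1.comp (φ := WithLp.toLp 2) (ψ := WithLp.toLp 2) (by fun_prop) (by fun_prop)
  have hXint : Integrable X P := h.prior.hasGaussianLaw.integrable
  have hYint : Integrable Y P := hYlaw.snd.integrable
  have hBYint : Integrable (fun ω => toEuclideanLin B (Y ω)) P :=
    (LinearMap.toContinuousLinearMap (toEuclideanLin B)).integrable_comp hYint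
  have hRint : Integrable R P := hXint.sub hBYint
  have hle : MeasurableSpace.comap Y inferInstance ≤ (inferInstance : MeasurableSpace Ω) :=
    h.measurable_data.comap_le
  have hRmeas : Measurable R := h.measurable_param.sub
    ((LinearMap.toContinuousLinearMap (toEuclideanLin B)).measurable.comp h.measurable_data)
  have hR0 : ∫ ω, R ω ∂P = 0 := by
    ext i
    have h1 := (EuclideanSpace.proj (𝕜 := ℝ) i).integral_comp_comm hRint
    have h2 := integral_mulVec_eq_zero hZ1 h.integral_paramNoise (fromCols (1 - B * G) (-B)) i
    simp only [← hRZ] at h2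
    exact h1.symm.trans h2
  have hcR : P[R | MeasurableSpace.comap Y inferInstance] =ᵐ[P] fun _ => ∫ ω, R ω ∂P :=
    condExp_indep_eq hRmeas.comap_le hle (comap_measurable R).stronglyMeasurable hind
  have hcBY : P[fun ω => toEuclideanLin B (Y ω) | MeasurableSpace.comap Y inferInstance] =
      fun ω => toEuclideanLin B (Y ω) :=
    condExp_of_stronglyMeasurable hle
      ((LinearMap.toContinuousLinearMap (toEuclideanLin B)).measurable.comp
        (comap_measurable Y)).stronglyMeasurable hBYint
  have hsum : X = R + fun ω => toEuclideanLin B (Y ω) := by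
    ext1 ω; simp [hR]
  have hadd := condExp_add hRint hBYint (MeasurableSpace.comap Y inferInstance)
  rw [← hsum, hcBY] at hadd
  filter_upwards [hadd, hcR] with ω h1 h2
  rw [posteriorMean, h1, Pi.add_apply, h2, hR0, zero_add]

end Model

/-! ### Matrix identities for the posterior covariance and gain. -/

section MatrixAlgebra

variable {n m : ℕ} {G : Matrix (Fin m) (Fin n) ℝ} {Γpr : Matrix (Fin n) (Fin n) ℝ}
  {Γobs : Matrix (Fin m) (Fin m) ℝ}

lemma posDef_hessian_add_inv (hpr : Γpr.PosDef) (hobs : Γobs.PosDef) :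
    (hessian G Γobs + Γpr⁻¹).PosDef := by
  refine Matrix.PosDef.posSemidef_add ?_ hpr.inv
  simpa [hessian] using hobs.inv.posSemidef.conjTranspose_mul_mul_same G

lemma isUnit_det_of_posDef {k : ℕ} {S : Matrix (Fin k) (Fin k) ℝ} (hS : S.PosDef) :
    IsUnit S.det := hS.det_pos.ne'.isUnit

lemma transpose_eq_of_posDef {k : ℕ} {S : Matrix (Fin k) (Fin k) ℝ} (hS : S.PosDef) :
    Sᵀ = S := by simpa using hS.isHermitian.eq

lemma inv_posteriorCov (hpr : Γpr.PosDef) (hobs : Γobs.PosDef) :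
    (posteriorCov G Γpr Γobs)⁻¹ = hessian G Γobs + Γpr⁻¹ :=
  nonsing_inv_nonsing_inv _ (isUnit_det_of_posDef (posDef_hessian_add_inv hpr hobs))

lemma posteriorCov_mul_hessian_add_inv (hpr : Γpr.PosDef) (hobs : Γobs.PosDef) :
    posteriorCov G Γpr Γobs * (hessian G Γobs + Γpr⁻¹) = 1 :=
  nonsing_inv_mul _ (isUnit_det_of_posDef (posDef_hessian_add_inv hpr hobs))

/-- The matrix `Γpos Gᵀ Γobs⁻¹` of the posterior mean. -/
noncomputable def posteriorGain (G : Matrix (Fin m) (Fin n) ℝ) (Γpr : Matrix (Fin n) (Fin n) ℝ)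
    (Γobs : Matrix (Fin m) (Fin m) ℝ) : Matrix (Fin n) (Fin m) ℝ :=
  posteriorCov G Γpr Γobs * Gᵀ * Γobs⁻¹

lemma posteriorCov_mul_hessian_mul_add (hpr : Γpr.PosDef) (hobs : Γobs.PosDef) :
    posteriorCov G Γpr Γobs * (hessian G Γobs * Γpr + 1) = Γpr := by
  have h : hessian G Γobs * Γpr + 1 = (hessian G Γobs + Γpr⁻¹) * Γpr := by
    rw [Matrix.add_mul, nonsing_inv_mul _ (isUnit_det_of_posDef hpr)]
  rw [h, ← Matrix.mul_assoc, posteriorCov_mul_hessian_add_inv hpr hobs, Matrix.one_mul]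

/-- The left side factors as `Γpos (H Γpr + 1) Gᵀ`. These are the normal equations that identify the
posterior mean. -/
lemma posteriorGain_mul (hpr : Γpr.PosDef) (hobs : Γobs.PosDef) :
    posteriorGain G Γpr Γobs * (G * Γpr * Gᵀ + Γobs) = Γpr * Gᵀ := by
  conv_rhs => rw [← posteriorCov_mul_hessian_mul_add (G := G) hpr hobs]
  rw [posteriorGain, Matrix.mul_add, Matrix.mul_assoc _ Γobs⁻¹ Γobs,
    nonsing_inv_mul _ (isUnit_det_of_posDef hobs), hessian]
  simp only [Matrix.mul_assoc, Matrix.mul_add, Matrix.add_mul, Matrix.mul_one]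

/-- Error covariance of a linear estimator: its excess over the posterior mean plus `Γpos`. -/
lemma errorCov_eq (hpr : Γpr.PosDef) (hobs : Γobs.PosDef) (A : Matrix (Fin n) (Fin m) ℝ) :
    (A * G - 1) * Γpr * (A * G - 1)ᵀ + A * Γobs * Aᵀ =
      (A - posteriorGain G Γpr Γobs) * (G * Γpr * Gᵀ + Γobs) *
        (A - posteriorGain G Γpr Γobs)ᵀ + posteriorCov G Γpr Γobs := by
  have h1 := posteriorGain_mul (G := G) hpr hobs
  have h3 : posteriorGain G Γpr Γobs * G * Γpr + posteriorCov G Γpr Γobs = Γpr := by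
    conv_rhs => rw [← posteriorCov_mul_hessian_mul_add (G := G) hpr hobs]
    rw [posteriorGain, hessian, Matrix.mul_add, Matrix.mul_one]
    simp only [Matrix.mul_assoc]
  set B := posteriorGain G Γpr Γobs
  set V := G * Γpr * Gᵀ + Γobs with hV
  have hprt := transpose_eq_of_posDef hpr
  have hVt : Vᵀ = V := by
    simp [hV, transpose_eq_of_posDef hobs, hprt, Matrix.mul_assoc]
  have h2 : V * Bᵀ = G * Γpr := by
    have := congrArg transpose h1
    simpa [hVt, hprt] using this
  -- Law of total covariance: `B V Bᵀ` is the covariance of the posterior mean.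
  have h4 : B * V * Bᵀ + posteriorCov G Γpr Γobs = Γpr := by
    rw [Matrix.mul_assoc, h2, ← Matrix.mul_assoc, h3]
  have h5 : (A - B) * V * (A - B)ᵀ + posteriorCov G Γpr Γobs =
      A * V * Aᵀ - A * (V * Bᵀ) - B * V * Aᵀ +
        (B * V * Bᵀ + posteriorCov G Γpr Γobs) := by
    rw [transpose_sub]; simp only [Matrix.mul_sub, Matrix.sub_mul, Matrix.mul_assoc]; abel
  rw [h5, h4, h2, h1, hV]
  simp only [transpose_sub, transpose_mul, transpose_one, Matrix.mul_sub, Matrix.sub_mul,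
    Matrix.mul_add, Matrix.add_mul, Matrix.mul_assoc, Matrix.mul_one, Matrix.one_mul]
  abel

end MatrixAlgebra

/-! ### Whitening by the generalized eigenbasis. -/

section Eigenbasis

variable {n m : ℕ} {G : Matrix (Fin m) (Fin n) ℝ} {Γpr : Matrix (Fin n) (Fin n) ℝ}
  {Γobs : Matrix (Fin m) (Fin m) ℝ} {δ : Fin n → ℝ} {w : Fin n → Fin n → ℝ}

/-- The eigenvectors are the rows of `of w`, so `of w` is the transpose of the usual eigenvector
matrix. -/
lemma of_mul_mul_transpose_apply {k l : ℕ} (w : Fin k → Fin l → ℝ) (S : Matrix (Fin l) (Fin l) ℝ)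
    (i j : Fin k) : (of w * S * (of w)ᵀ) i j = w i ⬝ᵥ (S *ᵥ w j) := by
  rw [Matrix.mul_assoc, mul_apply]
  rfl

lemma eigenbasis_mul_inv_mul_transpose
    (hw_orth : ∀ i j, w i ⬝ᵥ (Γpr⁻¹ *ᵥ w j) = if i = j then 1 else 0) :
    of w * Γpr⁻¹ * (of w)ᵀ = 1 := by
  ext i j
  rw [of_mul_mul_transpose_apply, hw_orth, one_apply]

lemma eigenbasis_mul_hessian_mul_transpose
    (hw : ∀ i, IsGenEigenpair (hessian G Γobs) Γpr⁻¹ (δ i ^ 2) (w i))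
    (hw_orth : ∀ i j, w i ⬝ᵥ (Γpr⁻¹ *ᵥ w j) = if i = j then 1 else 0) :
    of w * hessian G Γobs * (of w)ᵀ = diagonal fun i => δ i ^ 2 := by
  ext i j
  rw [of_mul_mul_transpose_apply, (hw j).2, dotProduct_smul, hw_orth, diagonal_apply]
  split_ifs with h <;> simp [h]

lemma transpose_mul_eigenbasis_mul_inv
    (hw_orth : ∀ i j, w i ⬝ᵥ (Γpr⁻¹ *ᵥ w j) = if i = j then 1 else 0) :
    (of w)ᵀ * of w * Γpr⁻¹ = 1 := by
  rw [Matrix.mul_assoc]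
  exact mul_eq_one_comm.1 (eigenbasis_mul_inv_mul_transpose hw_orth)

/-- `w iᵀ H w i` is the squared `Γobs⁻¹`-norm of `G w i`. -/
lemma mulVec_eq_zero_of_eigenvalue_eq_zero (hobs : Γobs.PosDef) {i : Fin n}
    (hw : IsGenEigenpair (hessian G Γobs) Γpr⁻¹ (δ i ^ 2) (w i)) (hi : δ i = 0) :
    G *ᵥ w i = 0 := by
  by_contra hne
  have hpos := hobs.inv.dotProduct_mulVec_pos hne
  have h0 : w i ⬝ᵥ (hessian G Γobs *ᵥ w i) = 0 := by simp [hw.2, hi]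
  rw [hessian, ← mulVec_mulVec, ← mulVec_mulVec, dotProduct_mulVec, vecMul_transpose] at h0
  rw [star_trivial, h0] at hpos
  exact lt_irrefl _ hpos

/-- At most `m` of the generalized eigenvalues of the Hessian are nonzero. -/
lemma eigenvalue_eq_zero_of_le (hδ_nonneg : ∀ i, 0 ≤ δ i) (hδ_anti : Antitone δ)
    (hw : ∀ i, IsGenEigenpair (hessian G Γobs) Γpr⁻¹ (δ i ^ 2) (w i))
    (hw_orth : ∀ i j, w i ⬝ᵥ (Γpr⁻¹ *ᵥ w j) = if i = j then 1 else 0)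
    {i : Fin n} (hi : m ≤ i) : δ i = 0 := by
  by_contra hne
  have hrank : (diagonal fun i => δ i ^ 2).rank ≤ m := by
    rw [← eigenbasis_mul_hessian_mul_transpose hw hw_orth, hessian]
    calc _ ≤ _ := rank_mul_le_left _ _
      _ ≤ _ := rank_mul_le_right _ _
      _ ≤ _ := rank_mul_le_right _ _
      _ ≤ m := by simpa using rank_le_card_height G
  rw [rank_diagonal, Fintype.card_subtype] at hrank
  -- By monotonicity `δ i ≠ 0` would make the `i + 1 > m` entries up to `i` nonzero, against the
  -- rank bound.
  have hsub : Finset.Iic i ⊆ Finset.univ.filter fun j => δ j ^ 2 ≠ 0 := fun j hj => by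
    have h1 := hδ_anti (Finset.mem_Iic.1 hj)
    have h2 := lt_of_le_of_ne (hδ_nonneg i) (Ne.symm hne)
    simpa using (h2.trans_le h1).ne'
  have := Finset.card_le_card hsub
  rw [Fin.card_Iic] at this
  omega

/-- The whitening factor `F = (1 + Δ²)^{1/2} Wᵀ Γpr⁻¹`, satisfying `Fᵀ F = Γpos⁻¹`. -/
noncomputable def whitening (Γpr : Matrix (Fin n) (Fin n) ℝ) (δ : Fin n → ℝ)
    (w : Fin n → Fin n → ℝ) : Matrix (Fin n) (Fin n) ℝ :=
  diagonal (fun i => √(1 + δ i ^ 2)) * of w * Γpr⁻¹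

lemma sqrt_one_add_sq_ne_zero (x : ℝ) : √(1 + x ^ 2) ≠ 0 :=
  (Real.sqrt_pos.2 (by positivity)).ne'

lemma eigenbasis_mul_hessian_add_inv
    (hw : ∀ i, IsGenEigenpair (hessian G Γobs) Γpr⁻¹ (δ i ^ 2) (w i))
    (hw_orth : ∀ i j, w i ⬝ᵥ (Γpr⁻¹ *ᵥ w j) = if i = j then 1 else 0) :
    of w * (hessian G Γobs + Γpr⁻¹) =
      diagonal (fun i => 1 + δ i ^ 2) * (of w * Γpr⁻¹) := by
  have h : of w * (hessian G Γobs + Γpr⁻¹) * (of w)ᵀ = diagonal fun i => 1 + δ i ^ 2 := by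
    rw [Matrix.mul_add, Matrix.add_mul, eigenbasis_mul_hessian_mul_transpose hw hw_orth,
      eigenbasis_mul_inv_mul_transpose hw_orth, add_comm, ← diagonal_one, diagonal_add]
  rw [← h, Matrix.mul_assoc _ (of w)ᵀ, ← Matrix.mul_assoc (of w)ᵀ,
    transpose_mul_eigenbasis_mul_inv hw_orth, Matrix.mul_one]

/-- Writes the whitening factor with `Γpos⁻¹` as its right factor, which then cancels the `Γpos`
inside `posteriorGain`. -/
lemma diagonal_inv_mul_eigenbasis_mul
    (hw : ∀ i, IsGenEigenpair (hessian G Γobs) Γpr⁻¹ (δ i ^ 2) (w i))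
    (hw_orth : ∀ i j, w i ⬝ᵥ (Γpr⁻¹ *ᵥ w j) = if i = j then 1 else 0) :
    diagonal (fun i => (√(1 + δ i ^ 2))⁻¹) * of w * (hessian G Γobs + Γpr⁻¹) =
      whitening Γpr δ w := by
  rw [Matrix.mul_assoc, eigenbasis_mul_hessian_add_inv hw hw_orth, ← Matrix.mul_assoc,
    diagonal_mul_diagonal, whitening, Matrix.mul_assoc]
  congr 3
  ext i
  have := sqrt_one_add_sq_ne_zero (δ i)
  field_simp
  rw [Real.sq_sqrt (by positivity)]

lemma leftInverse_whitening
    (hw_orth : ∀ i j, w i ⬝ᵥ (Γpr⁻¹ *ᵥ w j) = if i = j then 1 else 0) :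
    (of w)ᵀ * diagonal (fun i => (√(1 + δ i ^ 2))⁻¹) * whitening Γpr δ w = 1 := by
  rw [whitening, Matrix.mul_assoc, Matrix.mul_assoc, ← Matrix.mul_assoc (diagonal _),
    diagonal_mul_diagonal]
  simp only [inv_mul_cancel₀ (sqrt_one_add_sq_ne_zero _), diagonal_one, Matrix.one_mul]
  rw [← Matrix.mul_assoc, transpose_mul_eigenbasis_mul_inv hw_orth]

lemma transpose_whitening_mul_whitening (hpr : Γpr.PosDef) (hobs : Γobs.PosDef)
    (hw : ∀ i, IsGenEigenpair (hessian G Γobs) Γpr⁻¹ (δ i ^ 2) (w i))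
    (hw_orth : ∀ i j, w i ⬝ᵥ (Γpr⁻¹ *ᵥ w j) = if i = j then 1 else 0) :
    (whitening Γpr δ w)ᵀ * whitening Γpr δ w = hessian G Γobs + Γpr⁻¹ := by
  have h1 := diagonal_inv_mul_eigenbasis_mul hw hw_orth
  have h2 := leftInverse_whitening (δ := δ) hw_orth
  have hSt := transpose_eq_of_posDef (posDef_hessian_add_inv (G := G) hpr hobs)
  have h3 := congrArg transpose h1
  rw [transpose_mul, hSt, transpose_mul, diagonal_transpose] at h3
  rw [← h3, Matrix.mul_assoc, h2, Matrix.mul_one]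

lemma whitening_mul_posteriorGain (hpr : Γpr.PosDef) (hobs : Γobs.PosDef)
    (hw : ∀ i, IsGenEigenpair (hessian G Γobs) Γpr⁻¹ (δ i ^ 2) (w i))
    (hw_orth : ∀ i j, w i ⬝ᵥ (Γpr⁻¹ *ᵥ w j) = if i = j then 1 else 0) :
    whitening Γpr δ w * posteriorGain G Γpr Γobs =
      diagonal (fun i => (√(1 + δ i ^ 2))⁻¹) * (of w * Gᵀ * Γobs⁻¹) := by
  have h : (hessian G Γobs + Γpr⁻¹) * posteriorCov G Γpr Γobs = 1 :=
    mul_eq_one_comm.1 (posteriorCov_mul_hessian_add_inv hpr hobs)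
  rw [← diagonal_inv_mul_eigenbasis_mul hw hw_orth, posteriorGain, Matrix.mul_assoc _ _ Γobs⁻¹,
    Matrix.mul_assoc, ← Matrix.mul_assoc _ (posteriorCov G Γpr Γobs), h, Matrix.one_mul]
  simp only [Matrix.mul_assoc]

/-- By the normal equations the factors `√(1 + δ²)` and their inverses cancel, leaving the Hessian
in its eigenbasis. -/
lemma whitened_posteriorGain_cov (hpr : Γpr.PosDef) (hobs : Γobs.PosDef)
    (hw : ∀ i, IsGenEigenpair (hessian G Γobs) Γpr⁻¹ (δ i ^ 2) (w i))
    (hw_orth : ∀ i j, w i ⬝ᵥ (Γpr⁻¹ *ᵥ w j) = if i = j then 1 else 0) :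
    whitening Γpr δ w * posteriorGain G Γpr Γobs * (G * Γpr * Gᵀ + Γobs) *
      (whitening Γpr δ w * posteriorGain G Γpr Γobs)ᵀ = diagonal fun i => δ i ^ 2 := by
  have hH := eigenbasis_mul_hessian_mul_transpose hw hw_orth
  rw [Matrix.mul_assoc (whitening Γpr δ w), posteriorGain_mul hpr hobs,
    whitening_mul_posteriorGain hpr hobs hw hw_orth, whitening]
  have h1 : diagonal (fun i => √(1 + δ i ^ 2)) * of w * Γpr⁻¹ * (Γpr * Gᵀ) =
      diagonal (fun i => √(1 + δ i ^ 2)) * (of w * Gᵀ) := by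
    rw [Matrix.mul_assoc _ Γpr⁻¹, ← Matrix.mul_assoc Γpr⁻¹,
      nonsing_inv_mul _ (isUnit_det_of_posDef hpr), Matrix.one_mul, Matrix.mul_assoc]
  have h2 : (of w * Gᵀ * Γobs⁻¹)ᵀ = Γobs⁻¹ * G * (of w)ᵀ := by
    simp [transpose_eq_of_posDef hobs.inv, Matrix.mul_assoc]
  have h3 : of w * Gᵀ * (Γobs⁻¹ * G * (of w)ᵀ) = of w * hessian G Γobs * (of w)ᵀ := by
    simp only [hessian, Matrix.mul_assoc]
  rw [h1, transpose_mul, diagonal_transpose, h2, ← Matrix.mul_assoc,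
    Matrix.mul_assoc (diagonal _), h3, hH, diagonal_mul_diagonal, diagonal_mul_diagonal]
  congr 1
  ext i
  have := sqrt_one_add_sq_ne_zero (δ i)
  field_simp

/-- In whitened coordinates `A*` keeps the first `r` rows of the posterior mean. -/
lemma whitening_mul_optimalLowRank (r : ℕ) (hpr : Γpr.PosDef) (hobs : Γobs.PosDef)
    (hδ_nonneg : ∀ i, 0 ≤ δ i) (hδ_anti : Antitone δ)
    (hw : ∀ i, IsGenEigenpair (hessian G Γobs) Γpr⁻¹ (δ i ^ 2) (w i))
    (hw_orth : ∀ i j, w i ⬝ᵥ (Γpr⁻¹ *ᵥ w j) = if i = j then 1 else 0)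
    {v : Fin m → Fin m → ℝ}
    (hpair : ∀ (i : Fin n) (j : Fin m), (i : ℕ) = (j : ℕ) →
      G *ᵥ w i = δ i • (Γobs *ᵥ v j)) :
    whitening Γpr δ w * optimalLowRank r δ w v =
      diagonal (fun i : Fin n => if (i : ℕ) < r then (1 : ℝ) else 0) *
        (whitening Γpr δ w * posteriorGain G Γpr Γobs) := by
  have hFw : ∀ k i, (whitening Γpr δ w *ᵥ w i) k = if k = i then √(1 + δ k ^ 2) else 0 := by
    intro k i
    rw [whitening, Matrix.mul_assoc, ← mulVec_mulVec, mulVec_diagonal, ← mulVec_mulVec]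
    have : (of w *ᵥ (Γpr⁻¹ *ᵥ w i)) k = w k ⬝ᵥ (Γpr⁻¹ *ᵥ w i) := rfl
    rw [this, hw_orth, mul_ite, mul_one, mul_zero]
  have hrow : ∀ k l, (of w * Gᵀ * Γobs⁻¹) k l = (Γobs⁻¹ *ᵥ (G *ᵥ w k)) l := by
    intro k l
    have h : of w * Gᵀ * Γobs⁻¹ = (Γobs⁻¹ * (G * (of w)ᵀ))ᵀ := by
      simp [transpose_eq_of_posDef hobs.inv]
    rw [h, transpose_apply, mul_apply]
    rfl
  rw [whitening_mul_posteriorGain hpr hobs hw hw_orth]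
  ext k l
  have hlhs : (whitening Γpr δ w * optimalLowRank r δ w v) k l =
      ∑ j : Fin m, if (k : ℕ) = (j : ℕ) ∧ (k : ℕ) < r then
        δ k / (1 + δ k ^ 2) * (√(1 + δ k ^ 2) * v j l) else 0 := by
    rw [optimalLowRank]
    simp only [Matrix.mul_sum, Matrix.sum_apply]
    rw [Finset.sum_eq_single k]
    · refine Finset.sum_congr rfl fun j _ => ?_
      split_ifs
      · rw [Matrix.mul_smul, mul_vecMulVec, Matrix.smul_apply, vecMulVec_apply, hFw, if_pos rfl,
          smul_eq_mul]
      · simp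
    · intro i _ hik
      refine Finset.sum_eq_zero fun j _ => ?_
      split_ifs
      · rw [Matrix.mul_smul, mul_vecMulVec, Matrix.smul_apply, vecMulVec_apply, hFw, if_neg hik.symm]
        simp
      · simp
    · simp
  rw [hlhs, diagonal_mul, diagonal_mul, hrow]
  by_cases hkr : (k : ℕ) < r
  · simp only [hkr, and_true, if_true, one_mul]
    rcases lt_or_ge (k : ℕ) m with hkm | hkm
    · rw [Finset.sum_eq_single ⟨k, hkm⟩, if_pos rfl, hpair k ⟨k, hkm⟩ rfl, mulVec_smul,
        mulVec_mulVec, nonsing_inv_mul _ (isUnit_det_of_posDef hobs), one_mulVec, Pi.smul_apply,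
        smul_eq_mul]
      · have := sqrt_one_add_sq_ne_zero (δ k)
        have h2 : √(1 + δ k ^ 2) ^ 2 = 1 + δ k ^ 2 := Real.sq_sqrt (by positivity)
        -- Turns every `1 + δ²` into the square of its root, so that the claim is rational in that
        -- root.
        rw [← h2, Real.sqrt_sq (Real.sqrt_nonneg _)]
        field_simp
      · intro j _ hj
        exact if_neg fun h => hj (Fin.ext h.symm)
      · simp
    -- For `k ≥ m` there is no matching `v`, but then `δ k = 0` and the row of the posterior mean
    -- vanishes too.
    · rw [mulVec_eq_zero_of_eigenvalue_eq_zero hobs (hw k)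
        (eigenvalue_eq_zero_of_le hδ_nonneg hδ_anti hw hw_orth hkm), mulVec_zero]
      rw [Finset.sum_eq_zero fun j _ => if_neg fun h => by omega]
      simp
  · simp [hkr]

/-- Undoing the whitening shows `A*` as a product through a diagonal matrix with at most `r` nonzero
entries. -/
lemma rank_optimalLowRank_le (r : ℕ) (hpr : Γpr.PosDef) (hobs : Γobs.PosDef)
    (hδ_nonneg : ∀ i, 0 ≤ δ i) (hδ_anti : Antitone δ)
    (hw : ∀ i, IsGenEigenpair (hessian G Γobs) Γpr⁻¹ (δ i ^ 2) (w i))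
    (hw_orth : ∀ i j, w i ⬝ᵥ (Γpr⁻¹ *ᵥ w j) = if i = j then 1 else 0)
    {v : Fin m → Fin m → ℝ}
    (hpair : ∀ (i : Fin n) (j : Fin m), (i : ℕ) = (j : ℕ) →
      G *ᵥ w i = δ i • (Γobs *ᵥ v j)) :
    (optimalLowRank r δ w v).rank ≤ r := by
  have h := whitening_mul_optimalLowRank r hpr hobs hδ_nonneg hδ_anti hw hw_orth hpair
  have h2 := leftInverse_whitening (δ := δ) hw_orth
  rw [← Matrix.one_mul (optimalLowRank r δ w v), ← h2, Matrix.mul_assoc, h]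
  refine (rank_mul_le_right _ _).trans ((rank_mul_le_left _ _).trans ?_)
  rw [rank_diagonal, Fintype.card_subtype]
  have : (Finset.univ.filter fun i : Fin n => (if (i : ℕ) < r then (1 : ℝ) else 0) ≠ 0).card ≤
      (Finset.range r).card :=
    Finset.card_le_card_of_injOn (fun i => (i : ℕ)) (fun i hi => by simpa using hi)
      (fun i _ j _ hij => Fin.ext hij)
  simpa using this

/-! ### The excess risk as a Frobenius distance. -/

lemma exists_mul_transpose_eq {k : ℕ} {S : Matrix (Fin k) (Fin k) ℝ} (hS : S.PosSemidef) :
    ∃ L : Matrix (Fin k) (Fin k) ℝ, L * Lᵀ = S := by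
  open scoped MatrixOrder Matrix.Norms.L2Operator in
  obtain ⟨B, hB⟩ := CStarAlgebra.nonneg_iff_eq_star_mul_self.1 hS.nonneg
  exact ⟨Bᵀ, by simpa [star_eq_conjTranspose] using hB.symm⟩

lemma trace_gram_mul {k l : ℕ} (F : Matrix (Fin k) (Fin k) ℝ) (A : Matrix (Fin k) (Fin l) ℝ)
    (L : Matrix (Fin l) (Fin l) ℝ) :
    (Fᵀ * F * (A * (L * Lᵀ) * Aᵀ)).trace = ((F * A * L) * (F * A * L)ᵀ).trace := by
  rw [Matrix.mul_assoc, trace_mul_comm]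
  simp only [transpose_mul, Matrix.mul_assoc]

lemma posSemidef_dataCov (hpr : Γpr.PosDef) (hobs : Γobs.PosDef) :
    (G * Γpr * Gᵀ + Γobs).PosSemidef := by
  refine Matrix.PosSemidef.add ?_ hobs.posSemidef
  simpa using hpr.posSemidef.mul_mul_conjTranspose_same G

/-- Eckart-Young applied to `F A L` and `F B L`; multiplying by `F` and `L` does not raise the rank
of `A`. -/
lemma sum_tail_le_excessRisk {r : ℕ} (hpr : Γpr.PosDef) (hobs : Γobs.PosDef)
    (hδ_nonneg : ∀ i, 0 ≤ δ i) (hδ_anti : Antitone δ)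
    (hw : ∀ i, IsGenEigenpair (hessian G Γobs) Γpr⁻¹ (δ i ^ 2) (w i))
    (hw_orth : ∀ i j, w i ⬝ᵥ (Γpr⁻¹ *ᵥ w j) = if i = j then 1 else 0)
    {A : Matrix (Fin n) (Fin m) ℝ} (hA : A.rank ≤ r) :
    ∑ i ∈ Finset.univ.filter (fun i : Fin n => r ≤ (i : ℕ)), δ i ^ 2 ≤
      ((hessian G Γobs + Γpr⁻¹) * ((A - posteriorGain G Γpr Γobs) * (G * Γpr * Gᵀ + Γobs) *
        (A - posteriorGain G Γpr Γobs)ᵀ)).trace := by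
  obtain ⟨L, hL⟩ := exists_mul_transpose_eq (posSemidef_dataCov (G := G) hpr hobs)
  have hcov := whitened_posteriorGain_cov hpr hobs hw hw_orth
  rw [← transpose_whitening_mul_whitening hpr hobs hw hw_orth, ← hL, trace_gram_mul,
    Matrix.mul_sub, Matrix.sub_mul]
  refine sum_tail_le_trace_sub_mul_transpose
    (fun i j hij => pow_le_pow_left₀ (hδ_nonneg j) (hδ_anti hij) 2) (fun i => sq_nonneg _) ?_
    ((rank_mul_le_left _ _).trans ((rank_mul_le_right _ _).trans hA))
  rw [← hcov, ← hL, transpose_mul]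
  simp only [Matrix.mul_assoc]

lemma excessRisk_optimalLowRank (r : ℕ) (hpr : Γpr.PosDef) (hobs : Γobs.PosDef)
    (hδ_nonneg : ∀ i, 0 ≤ δ i) (hδ_anti : Antitone δ)
    (hw : ∀ i, IsGenEigenpair (hessian G Γobs) Γpr⁻¹ (δ i ^ 2) (w i))
    (hw_orth : ∀ i j, w i ⬝ᵥ (Γpr⁻¹ *ᵥ w j) = if i = j then 1 else 0)
    {v : Fin m → Fin m → ℝ}
    (hpair : ∀ (i : Fin n) (j : Fin m), (i : ℕ) = (j : ℕ) →
      G *ᵥ w i = δ i • (Γobs *ᵥ v j)) :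
    ((hessian G Γobs + Γpr⁻¹) * ((optimalLowRank r δ w v - posteriorGain G Γpr Γobs) *
      (G * Γpr * Gᵀ + Γobs) * (optimalLowRank r δ w v - posteriorGain G Γpr Γobs)ᵀ)).trace =
      ∑ i ∈ Finset.univ.filter (fun i : Fin n => r ≤ (i : ℕ)), δ i ^ 2 := by
  obtain ⟨L, hL⟩ := exists_mul_transpose_eq (posSemidef_dataCov (G := G) hpr hobs)
  have hcov := whitened_posteriorGain_cov hpr hobs hw hw_orth
  rw [← hL] at hcov
  rw [← transpose_whitening_mul_whitening hpr hobs hw hw_orth, ← hL, trace_gram_mul,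
    Matrix.mul_sub, whitening_mul_optimalLowRank r hpr hobs hδ_nonneg hδ_anti hw hw_orth hpair]
  set D := whitening Γpr δ w * posteriorGain G Γpr Γobs
  set E := diagonal (fun i : Fin n => if (i : ℕ) < r then (1 : ℝ) else 0) with hE
  -- The truncation error is `(E - 1) D`, and `E - 1` retains, up to sign, exactly the coordinates
  -- from `r` on.
  have h : (E * D - D) * L * ((E * D - D) * L)ᵀ = (E - 1) * (D * (L * Lᵀ) * Dᵀ) * (E - 1)ᵀ := by
    rw [show E * D - D = (E - 1) * D by rw [Matrix.sub_mul, Matrix.one_mul]]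
    simp only [transpose_mul, Matrix.mul_assoc]
  rw [h, hcov, hE, ← diagonal_one, diagonal_sub, diagonal_transpose, diagonal_mul_diagonal,
    diagonal_mul_diagonal, trace_diagonal, Finset.sum_filter]
  refine Finset.sum_congr rfl fun i _ => ?_
  by_cases hi : (i : ℕ) < r
  · simp [hi, not_le.2 hi]
  · simp [hi, not_lt.1 hi]

end Eigenbasis

/-! ### Assembly of the risk formula and its minimum. -/

theorem theorem4p1 {n m : ℕ} (r : ℕ)
    (G : Matrix (Fin m) (Fin n) ℝ)
    (Γpr : Matrix (Fin n) (Fin n) ℝ) (hpr : Γpr.PosDef)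
    (Γobs : Matrix (Fin m) (Fin m) ℝ) (hobs : Γobs.PosDef)
    {Ω : Type*} [MeasurableSpace Ω] (P : Measure Ω) [IsProbabilityMeasure P]
    (X : Ω → EuclideanSpace ℝ (Fin n)) (Y : Ω → EuclideanSpace ℝ (Fin m))
    (hmodel : IsLinearGaussianModel P G Γpr Γobs X Y)
    -- the eigenpairs `(δ_i², w_i)` of `(H, Γpr⁻¹)`, orthonormal for `Γpr⁻¹`
    (δ : Fin n → ℝ) (w : Fin n → Fin n → ℝ)
    (hδ_nonneg : ∀ i, 0 ≤ δ i) (hδ_anti : Antitone δ)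
    (hw : ∀ i, IsGenEigenpair (hessian G Γobs) Γpr⁻¹ (δ i ^ 2) (w i))
    (hw_orth : ∀ i j, w i ⬝ᵥ (Γpr⁻¹ *ᵥ w j) = if i = j then 1 else 0)
    -- the eigenvectors `v_i` of `(G Γpr Gᵀ, Γobs)`, normalized by `Γobs`
    (η : Fin m → ℝ) (v : Fin m → Fin m → ℝ) (hη_anti : Antitone η)
    (hv : ∀ j, IsGenEigenpair (G * Γpr * Gᵀ) Γobs (η j) (v j))
    (hv_norm : ∀ j, v j ⬝ᵥ (Γobs *ᵥ v j) = 1)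
    -- `w_i` and `v_i` belong to the same singular triplet: `G w_i = δ_i Γobs v_i`
    (hpair : ∀ (i : Fin n) (j : Fin m), (i : ℕ) = (j : ℕ) →
      G *ᵥ w i = δ i • (Γobs *ᵥ v j)) :
    -- all the expectations below are finite
    (∀ A : Matrix (Fin n) (Fin m) ℝ, Integrable (fun ω =>
      weightedSq (posteriorCov G Γpr Γobs)⁻¹ (toEuclideanLin A (Y ω) - X ω)) P) ∧
    Integrable (fun ω => weightedSq (posteriorCov G Γpr Γobs)⁻¹
      (toEuclideanLin (optimalLowRank r δ w v) (Y ω) - posteriorMean P X Y ω)) P ∧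
    Integrable (fun ω => weightedSq (posteriorCov G Γpr Γobs)⁻¹
      (posteriorMean P X Y ω - X ω)) P ∧
    -- (i) optimality among the matrices of rank at most `r`
    (optimalLowRank r δ w v ∈ rankAtMost n m r ∧
      IsMinOn (linearBayesRisk P X Y (posteriorCov G Γpr Γobs)⁻¹) (rankAtMost n m r)
        (optimalLowRank r δ w v)) ∧
    -- (ii) the minimal risk
    linearBayesRisk P X Y (posteriorCov G Γpr Γobs)⁻¹ (optimalLowRank r δ w v) =
      (∫ ω, weightedSq (posteriorCov G Γpr Γobs)⁻¹
        (toEuclideanLin (optimalLowRank r δ w v) (Y ω) - posteriorMean P X Y ω) ∂P) +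
      (∫ ω, weightedSq (posteriorCov G Γpr Γobs)⁻¹ (posteriorMean P X Y ω - X ω) ∂P) ∧
    linearBayesRisk P X Y (posteriorCov G Γpr Γobs)⁻¹ (optimalLowRank r δ w v) =
      (∑ i ∈ Finset.univ.filter (fun i : Fin n => r ≤ (i : ℕ)), δ i ^ 2) + (n : ℝ) := by
  have hprs := hpr.posSemidef
  have hobss := hobs.posSemidef
  set B := posteriorGain G Γpr Γobs
  have hmean : posteriorMean P X Y =ᵐ[P] fun ω => toEuclideanLin B (Y ω) :=
    hmodel.posteriorMean_ae_eq hprs hobss (posteriorGain_mul hpr hobs)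
  have herr : ∀ (A : Matrix (Fin n) (Fin m) ℝ) ω, (toEuclideanLin A (Y ω) - X ω).ofLp =
      fromCols (A * G - 1) A *ᵥ paramNoise G X Y ω := fun A ω => by
    rw [fromCols_mulVec_paramNoise]
    simp [Matrix.sub_mulVec, Matrix.mulVec_sub]
  have hdiff : ∀ (A : Matrix (Fin n) (Fin m) ℝ) ω,
      (toEuclideanLin A (Y ω) - toEuclideanLin B (Y ω)).ofLp =
        fromCols ((A - B) * G) (A - B) *ᵥ paramNoise G X Y ω := fun A ω => by
    rw [fromCols_mulVec_paramNoise]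
    simp [Matrix.sub_mulVec, Matrix.mulVec_sub, Matrix.sub_mul]
  rw [inv_posteriorCov hpr hobs]
  set S := hessian G Γobs + Γpr⁻¹ with hS
  set V := G * Γpr * Gᵀ + Γobs with hV
  set A' := optimalLowRank r δ w v
  have htr : (S * posteriorCov G Γpr Γobs).trace = n := by
    rw [mul_eq_one_comm.1 (posteriorCov_mul_hessian_add_inv hpr hobs), trace_one,
      Fintype.card_fin]
  have hrisk : ∀ A, linearBayesRisk P X Y S A = (S * ((A - B) * V * (A - B)ᵀ)).trace + n :=
    fun A => by
      rw [linearBayesRisk, hmodel.integral_weightedSq hprs hobss S _ _ (herr A),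
        errorCov_eq hpr hobs, Matrix.mul_add, trace_add, htr]
  have hexcess := excessRisk_optimalLowRank r hpr hobs hδ_nonneg hδ_anti hw hw_orth hpair
  have hint1 : (fun ω => weightedSq S (toEuclideanLin A' (Y ω) - posteriorMean P X Y ω)) =ᵐ[P]
      fun ω => weightedSq S (toEuclideanLin A' (Y ω) - toEuclideanLin B (Y ω)) := by
    filter_upwards [hmean] with ω hω
    rw [hω]
  have hint2 : (fun ω => weightedSq S (posteriorMean P X Y ω - X ω)) =ᵐ[P]
      fun ω => weightedSq S (toEuclideanLin B (Y ω) - X ω) := by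
    filter_upwards [hmean] with ω hω
    rw [hω]
  refine ⟨fun A => hmodel.integrable_weightedSq S _ _ (herr A),
    (integrable_congr hint1).2 (hmodel.integrable_weightedSq S _ _ (hdiff A')),
    (integrable_congr hint2).2 (hmodel.integrable_weightedSq S _ _ (herr B)),
    ⟨rank_optimalLowRank_le r hpr hobs hδ_nonneg hδ_anti hw hw_orth hpair, fun A hA => ?_⟩,
    ?_, ?_⟩
  · have := sum_tail_le_excessRisk hpr hobs hδ_nonneg hδ_anti hw hw_orth
      (show A.rank ≤ r from hA)
    simp only [Set.mem_ofPred_eq]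
    rw [hrisk, hrisk, hexcess]
    linarith
  -- The risk formula at `A = B`, where the excess vanishes.
  · have h2 : ∫ ω, weightedSq S (toEuclideanLin B (Y ω) - X ω) ∂P = n := by
      have := hrisk B
      rw [linearBayesRisk] at this
      simpa using this
    rw [integral_congr_ae hint1, integral_congr_ae hint2, h2,
      hmodel.integral_weightedSq hprs hobss S _ _ (hdiff A'), hrisk]
    congr 3
    rw [hV, transpose_mul]
    simp only [Matrix.mul_add, Matrix.add_mul, Matrix.mul_assoc]
  · rw [hrisk, hexcess]
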